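/- Let $H_1,H_2,U$ be complex Hilbert spaces and, for $i=1,2$, let $A_i$ be a self-adjoint operator in $H_i$ that is positive, i.e. $\langle A_ix,x\rangle\ge c_i\|x\|^2$ on $\mathcal D(A_i)$ for some $c_i>0$. Put $H_{i,1}=\mathcal D(A_i)$, let $H_{i,1/2}=\mathcal D(A_i^{1/2})$ with norm $\|A_i^{1/2}z\|$, and let $H_{i,-1/2}$ be its dual with respect to the pivot space $H_i$. Let $B:U\to H_{1,-1/2}$ be bounded, with adjoint $B^*:H_{1,1/2}\to U$, and let $C$ be a linear operator from $\mathcal D(C)\subset H_2$ to $H_1$ with $H_{2,1/2}\subset\mathcal D(C)$ and $H_{1,1/2}\subset\mathcal D(C^*)$. The operators $A_i:H_{i,1/2}\to H_{i,-1/2}$, $A_2^{1/2}:H_2\to H_{2,-1/2}$, $C:H_2\to H_{1,-1/2}$, $C^*:H_1\to H_{2,-1/2}$ are understood as the bounded extensions. Consider for $t\ge0$ the systems $$(1)\quad \ddot w_1+A_1w_1+BB^*\dot w_1+C\dot w_2=0,\qquad \ddot w_2+A_2w_2-C^*\dot w_1=0,$$ $$(2)\quad \ddot u+(A_1+CC^*)u+BB^*\dot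 u+CA_2^{1/2}v=0,\qquad \ddot v+A_2v+A_2^{1/2}C^*u=0,$$ the first equation of each system being an equation in $H_{1,-1/2}$ and the second one in $H_{2,-1/2}$. Let $\mathcal H=H_{1,1/2}\times H_{2,1/2}\times H_1\times H_2$. A *classical solution* of (1) is a pair with $w_i\in C^1([0,\infty);H_{i,1/2})\cap C^2([0,\infty);H_i)$ that satisfies (1) for all $t\ge0$. An *energy solution* of (1) is a pair with $w_i\in C([0,\infty);H_{i,1/2})\cap C^1([0,\infty);H_i)$ and $B^*w_1\in H^1(0,T;U)$ for all $T>0$, such that, with $B^*\dot w_1:=\frac{d}{dt}(B^*w_1)$, one has $\dot w_1\in H^1(0,T;H_{1,-1/2})$ for all $T>0$ with weak derivative $-(A_1w_1+BB^*\dot w_1+C\dot w_2)$, and $\dot w_2$ is differentiable in $H_{2,-1/2}$ with derivative $-A_2w_2+C^*\dot w_1$ at every $t\ge0$. Classical and energy solutions $(u,v)$ of (2) are defined in the same way. The initial data of a solution of (1) are $(w_1,w_2,\dot w_1,\dot w_2)(0)\in\mathcal H$, and similarly for (2). Let $$\mathcal A_1(u_1,v_1,u_2,v_2)=\big(u_2,\;v_2,\;-(A_1u_1+BB^*u_2)-Cv_2,\;-A_2v_1+C^*u_2\big),$$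 $$\mathcal A_2(u_1,v_1,u_2,v_2)=\big(u_2,\;v_2,\;-(A_1u_1+BB^*u_2)-C(C^*u_1+A_2^{1/2}v_1),\;-A_2^{1/2}(C^*u_1+A_2^{1/2}v_1)\big)$$ with domains $$\mathcal D(\mathcal A_1)=\{(u_1,v_1,u_2,v_2)\in H_{1,1/2}\times H_{2,1}\times H_{1,1/2}\times H_{2,1/2}:\ A_1u_1+BB^*u_2\in H_1\},$$ $$\mathcal D(\mathcal A_2)=\{(u_1,v_1,u_2,v_2)\in H_{1,1/2}\times H_{2,1/2}\times H_{1,1/2}\times H_{2,1/2}:\ A_1u_1+BB^*u_2\in H_1,\ C^*u_1+A_2^{1/2}v_1\in H_{2,1/2}\}.$$ **Theorem.** The formula $$P(a,b,c,d)=\big(a,\;-A_2^{-1/2}C^*a+A_2^{-1/2}d,\;c,\;-A_2^{1/2}b\big)$$ defines a bounded invertible operator $P$ on $\mathcal H$ with bounded inverse $$P^{-1}(a,b,c,d)=\big(a,\;-A_2^{-1/2}d,\;c,\;C^*a+A_2^{1/2}b\big),$$ and $\mathcal A_1=P^{-1}\mathcal A_2P$, including equality of domains. For every $X_0\in\mathcal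 H$, the map $$(w_1,w_2)\mapsto(u,v),\qquad u=w_1,\quad v=A_2^{-1/2}\dot w_2-A_2^{-1/2}C^*w_1,$$ is a bijection from the energy solutions of (1) with initial data $X_0$ onto the energy solutions of (2) with initial data $PX_0$, its inverse is $$w_1=u,\qquad w_2=-A_2^{-1/2}\dot v,$$ and $(u,v,\dot u,\dot v)(t)=P\,(w_1,w_2,\dot w_1,\dot w_2)(t)$ for all $t\ge0$. The same holds with classical solutions in place of energy solutions. -/

import Mathlib

open scoped LinearPMap InnerProductSpace ComplexConjugate NNReal
open MeasureTheory

noncomputable section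

/-- A positive self-adjoint (in general unbounded) operator on the complex Hilbert space `H`.
Positive means bounded below by a positive constant, so that the negative powers are bounded
operators and `‖A^{1/2} z‖` is a complete norm on `D(A^{1/2})`. -/
structure PosSelfAdjoint (H : Type*) [NormedAddCommGroup H] [InnerProductSpace ℂ H]
    [CompleteSpace H] where
  op : H →ₗ.[ℂ] H
  selfAdjoint : IsSelfAdjoint op
  positive : ∃ c : ℝ, 0 < c ∧ ∀ x : op.domain, c * ‖(x : H)‖ ^ 2 ≤ (⟪(x : H), op x⟫_ℂ).re

namespace PosSelfAdjoint

section Powers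

variable {H : Type*} [NormedAddCommGroup H] [InnerProductSpace ℂ H] [CompleteSpace H]
variable (A : PosSelfAdjoint H)

theorem exists_bound : ∃ c : ℝ, 0 < c ∧ ∀ x : A.op.domain, c * ‖(x : H)‖ ≤ ‖A.op x‖ := by
  obtain ⟨c, hc, h⟩ := A.positive
  refine ⟨c, hc, fun x => ?_⟩
  rcases eq_or_ne (x : H) 0 with hx | hx
  · simp [hx]
  · have h1 := h x
    have h2 : (⟪(x : H), A.op x⟫_ℂ).re ≤ ‖(x : H)‖ * ‖A.op x‖ :=
      (Complex.re_le_norm _).trans (norm_inner_le_norm _ _)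
    have h3 : 0 < ‖(x : H)‖ := norm_pos_iff.mpr hx
    have h4 : ‖(x : H)‖ * (c * ‖(x : H)‖) ≤ ‖(x : H)‖ * ‖A.op x‖ := by nlinarith
    exact le_of_mul_le_mul_left h4 h3

theorem op_injective : Function.Injective A.op.toFun := by
  obtain ⟨c, hc, h⟩ := A.exists_bound
  rw [← LinearMap.ker_eq_bot, LinearMap.ker_eq_bot']
  intro x hx
  have h1 := h x
  have h2 : A.op x = 0 := hx
  rw [h2, norm_zero] at h1
  have : ‖(x : H)‖ ≤ 0 := by
    by_contra h3
    push Not at h3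
    nlinarith [mul_pos hc h3]
  exact Subtype.ext (norm_le_zero_iff.mp this)

theorem op_surjective : Function.Surjective A.op.toFun := by
  obtain ⟨c, hc, h⟩ := A.exists_bound
  have hclosed : IsClosed (A.op.graph : Set (H × H)) := A.selfAdjoint.isClosed
  have : CompleteSpace A.op.graph := hclosed.completeSpace_coe
  let p : A.op.graph →L[ℂ] H := (ContinuousLinearMap.snd ℂ H H).comp A.op.graph.subtypeL
  have hp : ∀ x, ‖x‖ ≤ (Real.toNNReal (max 1 c⁻¹) : ℝ≥0) * ‖p x‖ := by
    rintro ⟨⟨x, y⟩, hxy⟩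
    obtain ⟨z, hz1, hz2⟩ := (LinearPMap.mem_graph_iff _).1 hxy
    simp only at hz1 hz2
    subst hz1
    have h1 := h z
    rw [hz2] at h1
    rw [Real.coe_toNNReal _ (le_trans zero_le_one (le_max_left _ _))]
    change max ‖(z : H)‖ ‖y‖ ≤ _ * ‖y‖
    refine max_le ?_ ?_
    · have : ‖(z : H)‖ ≤ c⁻¹ * ‖y‖ := by
        rw [inv_mul_eq_div, le_div_iff₀ hc]
        linarith
      exact this.trans (mul_le_mul_of_nonneg_right (le_max_right _ _) (norm_nonneg _))
    · nlinarith [le_max_left 1 c⁻¹, norm_nonneg y]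
  have hr : IsClosed (Set.range p) :=
    (p.antilipschitz_of_bound hp).isClosed_range p.uniformContinuous
  have hrange : (Set.range p) = (LinearMap.range A.op.toFun : Set H) := by
    ext y
    constructor
    · rintro ⟨⟨⟨x, y'⟩, hxy⟩, rfl⟩
      obtain ⟨z, hz1, hz2⟩ := (LinearPMap.mem_graph_iff _).1 hxy
      exact ⟨z, hz2⟩
    · rintro ⟨x, rfl⟩
      exact ⟨⟨(x, A.op x), A.op.mem_graph x⟩, rfl⟩
  rw [hrange] at hr
  have horth : (LinearMap.range A.op.toFun)ᗮ = ⊥ := by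
    rw [Submodule.eq_bot_iff]
    intro y hy
    have hy' : ∀ x : A.op.domain, ⟪(0 : H), (x : H)⟫_ℂ = ⟪y, A.op x⟫_ℂ := by
      intro x
      rw [inner_zero_left]
      exact ((Submodule.mem_orthogonal' _ _).1 hy _ ⟨x, rfl⟩).symm
    have hmem := LinearPMap.mem_adjoint_domain_of_exists (T := A.op) y ⟨0, hy'⟩
    have hval := LinearPMap.adjoint_apply_eq (T := A.op) A.selfAdjoint.dense_domain ⟨y, hmem⟩ hy'
    have hg : (y, (0 : H)) ∈ (A.op)†.graph :=
      (LinearPMap.mem_graph_iff _).2 ⟨⟨y, hmem⟩, rfl, hval⟩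
    rw [show (A.op)† = A.op from A.selfAdjoint] at hg
    obtain ⟨z, hz1, hz2⟩ := (LinearPMap.mem_graph_iff _).1 hg
    have hz : z = 0 := A.op_injective (hz2.trans (map_zero A.op.toFun).symm)
    simpa [hz] using hz1.symm
  have htop := (Submodule.topologicalClosure_eq_top_iff).2 horth
  rw [IsClosed.submodule_topologicalClosure_eq hr] at htop
  exact LinearMap.range_eq_top.1 htop

def opEquiv : A.op.domain ≃ₗ[ℂ] H :=
  LinearEquiv.ofBijective A.op.toFun ⟨A.op_injective, A.op_surjective⟩

theorem exists_inv_bound : ∃ K : ℝ, ∀ y : H, ‖((A.opEquiv.symm y : A.op.domain) : H)‖ ≤ K * ‖y‖ := by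
  obtain ⟨c, hc, h⟩ := A.exists_bound
  refine ⟨c⁻¹, fun y => ?_⟩
  have h1 := h (A.opEquiv.symm y)
  have h2 : A.op (A.opEquiv.symm y) = y := A.opEquiv.apply_symm_apply y
  rw [h2] at h1
  rw [inv_mul_eq_div, le_div_iff₀ hc]
  linarith

/-- The bounded operator `A⁻¹` on `H`. -/
def inv : H →L[ℂ] H :=
  (A.op.domain.subtype ∘ₗ A.opEquiv.symm.toLinearMap).mkContinuousOfExistsBound A.exists_inv_bound

theorem inv_injective : Function.Injective A.inv := fun _ _ h =>
  A.opEquiv.symm.injective (Subtype.ext h)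

theorem inv_nonneg : 0 ≤ A.inv := by
  rw [ContinuousLinearMap.nonneg_iff_isPositive, ContinuousLinearMap.isPositive_iff_complex]
  intro y
  obtain ⟨c, hc, h⟩ := A.positive
  set x := A.opEquiv.symm y with hx
  have hy : A.op x = y := A.opEquiv.apply_symm_apply y
  have hdef : A.inv y = (x : H) := rfl
  rw [hdef]
  have hsym : ⟪A.op x, (x : H)⟫_ℂ = ⟪(x : H), A.op x⟫_ℂ := by
    have hf := LinearPMap.adjoint_isFormalAdjoint (T := A.op) A.selfAdjoint.dense_domain
    rw [show (A.op)† = A.op from A.selfAdjoint] at hf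
    exact hf x x
  have h1 := h x
  rw [hy] at h1 hsym
  refine ⟨?_, ?_⟩
  · have hc' : conj ⟪(x : H), y⟫_ℂ = ⟪(x : H), y⟫_ℂ := by
      rw [inner_conj_symm]; exact hsym
    exact Complex.conj_eq_iff_re.1 hc'
  · exact le_trans (by positivity) h1

/-- The bounded operator `A^{-1/2}` on `H`: the positive square root of `A⁻¹`. -/
def invSqrt : H →L[ℂ] H := CFC.sqrt A.inv

theorem invSqrt_mul_self : A.invSqrt * A.invSqrt = A.inv :=
  CFC.sqrt_mul_sqrt_self A.inv A.inv_nonneg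

theorem invSqrt_injective : Function.Injective A.invSqrt := fun x y h =>
  A.inv_injective (by
    rw [← A.invSqrt_mul_self]
    change A.invSqrt (A.invSqrt x) = A.invSqrt (A.invSqrt y)
    rw [h])

/-- The space `H_{1/2} = D(A^{1/2})`, that is, the range of `A^{-1/2}`. -/
def Half : Type _ := LinearMap.range A.invSqrt.toLinearMap

instance : AddCommGroup A.Half :=
  inferInstanceAs (AddCommGroup (LinearMap.range A.invSqrt.toLinearMap))

instance : Module ℂ A.Half :=
  inferInstanceAs (Module ℂ (LinearMap.range A.invSqrt.toLinearMap))

/-- The inclusion `D(A^{1/2}) ⊆ H`. -/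
def halfIncl : A.Half →ₗ[ℂ] H := (LinearMap.range A.invSqrt.toLinearMap).subtype

/-- The operator `A^{1/2} : D(A^{1/2}) → H`, a linear bijection with inverse `A^{-1/2}`. -/
def rootLin : A.Half ≃ₗ[ℂ] H :=
  (LinearEquiv.ofInjective A.invSqrt.toLinearMap A.invSqrt_injective).symm

/-- The norm of `H_{1/2}` is `‖z‖_{1/2} = ‖A^{1/2} z‖`. -/
instance : NormedAddCommGroup A.Half :=
  NormedAddCommGroup.induced A.Half H A.rootLin.toLinearMap A.rootLin.injective

instance : NormedSpace ℂ A.Half := NormedSpace.induced ℂ A.Half H A.rootLin.toLinearMap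

/-- `A^{1/2}` as an isometry of `H_{1/2}` onto `H`. -/
def root : A.Half ≃ₗᵢ[ℂ] H where
  toLinearEquiv := A.rootLin
  norm_map' _ := rfl

instance : CompleteSpace A.Half :=
  (completeSpace_congr (e := A.root.toEquiv) A.root.isometry.isUniformEmbedding).2 inferInstance

theorem halfIncl_eq (z : A.Half) : A.halfIncl z = A.invSqrt (A.root z) := by
  obtain ⟨y, rfl⟩ := A.root.symm.surjective z
  rw [LinearIsometryEquiv.apply_symm_apply]
  rfl

/-- The inclusion `H_{1/2} ⊆ H` as a bounded operator. -/
def emb : A.Half →L[ℂ] H where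
  toLinearMap := A.halfIncl
  cont := by
    have : (A.halfIncl : A.Half → H) = fun z => A.invSqrt (A.root z) := funext A.halfIncl_eq
    change Continuous (A.halfIncl : A.Half → H)
    rw [this]
    exact A.invSqrt.continuous.comp A.root.continuous

theorem emb_injective : Function.Injective A.emb := Subtype.val_injective

theorem op_domain_le : ∀ x ∈ A.op.domain, x ∈ LinearMap.range A.halfIncl := by
  intro x hx
  have h1 : A.inv (A.op ⟨x, hx⟩) = x :=
    congrArg Subtype.val (A.opEquiv.symm_apply_apply ⟨x, hx⟩)
  rw [← A.invSqrt_mul_self] at h1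
  exact ⟨⟨x, ⟨_, h1⟩⟩, rfl⟩

theorem emb_denseRange : DenseRange A.emb :=
  A.selfAdjoint.dense_domain.mono fun x hx => A.op_domain_le x hx

/-- The dual space `H_{-1/2} = (H_{1/2})*`, realised as the space of bounded conjugate-linear
functionals on `H_{1/2}` (`H` being the pivot space). -/
abbrev Dual : Type _ := A.Half →L⋆[ℂ] ℂ

/-- The dual of a bounded operator `T : H_{1/2} → K` into a Hilbert space `K` identified with its
dual, i.e. the bounded operator `T* : K → H_{-1/2}`, `(T* k)(z) = ⟨k, T z⟩`. -/
def dualMap {K : Type*} [NormedAddCommGroup K] [InnerProductSpace ℂ K] (T : A.Half →L[ℂ] K) :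
    K →L[ℂ] A.Dual :=
  ((ContinuousLinearMap.compSL A.Half K ℂ (RingHom.id ℂ) (starRingEnd ℂ)).flip T).comp
    (innerSL ℂ).flip

theorem dualMap_apply {K : Type*} [NormedAddCommGroup K] [InnerProductSpace ℂ K]
    (T : A.Half →L[ℂ] K) (k : K) (z : A.Half) : A.dualMap T k z = ⟪T z, k⟫_ℂ := rfl

/-- The inclusion `H ⊆ H_{-1/2}`. -/
def toDual : H →L[ℂ] A.Dual := A.dualMap A.emb

/-- The extension `A^{1/2} : H → H_{-1/2}`. -/
def rootExt : H →L[ℂ] A.Dual := A.dualMap (A.root : A.Half →L[ℂ] H)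

/-- The extension `A : H_{1/2} → H_{-1/2}`, `(A x)(z) = ⟨A^{1/2} x, A^{1/2} z⟩`. -/
def opExt : A.Half →L[ℂ] A.Dual := A.rootExt.comp (A.root : A.Half →L[ℂ] H)

theorem toDual_injective : Function.Injective A.toDual := by
  intro x y h
  refine A.emb_denseRange.eq_of_inner_right ℂ ?_
  intro z
  exact congrArg (fun f : A.Dual => f z) h

/-- The partial inverse of the inclusion `H_{1/2} ⊆ H`. -/
def lift : LinearMap.range A.emb.toLinearMap ≃ₗ[ℂ] A.Half :=
  (LinearEquiv.ofInjective A.emb.toLinearMap A.emb_injective).symm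

/-- The partial inverse of the inclusion `H ⊆ H_{-1/2}`. -/
def restrict : LinearMap.range A.toDual.toLinearMap ≃ₗ[ℂ] H :=
  (LinearEquiv.ofInjective A.toDual.toLinearMap A.toDual_injective).symm

/-- For a bounded `B : U → H_{-1/2}`, where `U` is identified with its dual, the adjoint
`B* : H_{1/2} → U`, characterised by `⟨B* z, u⟩_U = (B u)(z)`. -/
def controlAdj {U : Type*} [NormedAddCommGroup U] [InnerProductSpace ℂ U] [CompleteSpace U]
    (B : U →L[ℂ] A.Dual) : A.Half →L[ℂ] U :=
  ((InnerProductSpace.toDual ℂ U).symm.toContinuousLinearEquiv :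
    StrongDual ℂ U →L⋆[ℂ] U).comp B.flip

theorem controlAdj_inner {U : Type*} [NormedAddCommGroup U] [InnerProductSpace ℂ U]
    [CompleteSpace U] (B : U →L[ℂ] A.Dual) (z : A.Half) (u : U) :
    ⟪A.controlAdj B z, u⟫_ℂ = B u z :=
  InnerProductSpace.toDual_symm_apply (y := B.flip z)

end Powers

end PosSelfAdjoint

/-- If `z ↦ ⟨g z, w⟩` is continuous for all `w` in a dense set, then `g` is continuous. -/
theorem continuous_of_weak {X K : Type*} [NormedAddCommGroup X] [NormedSpace ℂ X] [CompleteSpace X]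
    [NormedAddCommGroup K] [InnerProductSpace ℂ K] [CompleteSpace K] (g : X →ₗ[ℂ] K) (D : Set K)
    (hD : Dense D) (h : ∀ w ∈ D, Continuous fun z => ⟪g z, w⟫_ℂ) : Continuous g := by
  refine g.continuous_of_seq_closed_graph fun u x y hx hy => ?_
  refine hD.eq_of_inner_left ℂ fun w hw => ?_
  have h1 : Filter.Tendsto (fun n => ⟪g (u n), w⟫_ℂ) Filter.atTop (nhds ⟪y, w⟫_ℂ) :=
    hy.inner tendsto_const_nhds
  exact tendsto_nhds_unique h1 (((h w hw).tendsto x).comp hx)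

/-- The data of the coupled systems: positive self-adjoint operators `A₁`, `A₂` on the Hilbert
spaces `H₁`, `H₂`, a bounded control operator `B : U → H_{1,-1/2}`, and an unbounded coupling
operator `C` from `H₂` to `H₁` such that `H_{2,1/2} ⊆ D(C)` and `H_{1,1/2} ⊆ D(C*)`. (`C` is then
densely defined and closable, and both inclusions are automatically continuous.) -/
structure CoupledSystem (H₁ H₂ U : Type*)
    [NormedAddCommGroup H₁] [InnerProductSpace ℂ H₁] [CompleteSpace H₁]
    [NormedAddCommGroup H₂] [InnerProductSpace ℂ H₂] [CompleteSpace H₂]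
    [NormedAddCommGroup U] [InnerProductSpace ℂ U] [CompleteSpace U] where
  A₁ : PosSelfAdjoint H₁
  A₂ : PosSelfAdjoint H₂
  B : U →L[ℂ] A₁.Dual
  C : H₂ →ₗ.[ℂ] H₁
  half_le_dom : ∀ z : A₂.Half, A₂.emb z ∈ C.domain
  half_le_dom_adj : ∀ z : A₁.Half, A₁.emb z ∈ (C†).domain

/-- A function on `[0, ∞)`, extended to negative times by its value at `0`. -/
def timeExt {E : Type*} (f : ℝ≥0 → E) (s : ℝ) : E := f s.toNNReal

section Time

variable {E : Type*} [NormedAddCommGroup E] [NormedSpace ℝ E]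

/-- The time derivative on `[0, ∞)` (one-sided at `0`). -/
def timeDeriv (f : ℝ≥0 → E) (t : ℝ≥0) : E := derivWithin (timeExt f) (Set.Ici 0) t

/-- `f ∈ C¹([0, ∞); E)`. -/
structure IsC1 (f : ℝ≥0 → E) : Prop where
  diff : ∀ t : ℝ≥0, DifferentiableWithinAt ℝ (timeExt f) (Set.Ici 0) t
  cont : Continuous (timeDeriv f)

/-- `f ∈ H¹(0, T; E)` for all `T > 0`, with weak derivative `g`. -/
structure HasH1Deriv (f : ℝ≥0 → E) (g : ℝ → E) : Prop where
  memLp : ∀ T : ℝ, 0 < T → MemLp g 2 (volume.restrict (Set.Ioc 0 T))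
  eq_integral : ∀ t : ℝ≥0, f t = f 0 + ∫ s in (0 : ℝ)..t, g s

end Time

namespace CoupledSystem

variable {H₁ H₂ U : Type*}
  [NormedAddCommGroup H₁] [InnerProductSpace ℂ H₁] [CompleteSpace H₁]
  [NormedAddCommGroup H₂] [InnerProductSpace ℂ H₂] [CompleteSpace H₂]
  [NormedAddCommGroup U] [InnerProductSpace ℂ U] [CompleteSpace U]
variable (S : CoupledSystem H₁ H₂ U)

theorem dense_dom : Dense (S.C.domain : Set H₂) := by
  refine S.A₂.emb_denseRange.mono ?_
  rintro _ ⟨z, rfl⟩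
  exact S.half_le_dom z

theorem inner_adj (x : (S.C†).domain) (y : S.C.domain) :
    ⟪S.C† x, (y : H₂)⟫_ℂ = ⟪(x : H₁), S.C y⟫_ℂ :=
  LinearPMap.adjoint_isFormalAdjoint S.dense_dom x y

def couplingLin : S.A₂.Half →ₗ[ℂ] H₁ :=
  S.C.toFun ∘ₗ S.A₂.emb.toLinearMap.codRestrict S.C.domain S.half_le_dom

def couplingAdjLin : S.A₁.Half →ₗ[ℂ] H₂ :=
  (S.C†).toFun ∘ₗ S.A₁.emb.toLinearMap.codRestrict (S.C†).domain S.half_le_dom_adj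

/-- The restriction of `C` to `H_{2,1/2}`, a bounded operator `H_{2,1/2} → H₁`. -/
def coupling : S.A₂.Half →L[ℂ] H₁ where
  toLinearMap := S.couplingLin
  cont := by
    refine continuous_of_weak S.couplingLin (Set.range S.A₁.emb) S.A₁.emb_denseRange ?_
    rintro _ ⟨w, rfl⟩
    have : ∀ z, ⟪S.couplingLin z, S.A₁.emb w⟫_ℂ = ⟪S.A₂.emb z, S.couplingAdjLin w⟫_ℂ := by
      intro z
      rw [← inner_conj_symm, ← inner_conj_symm (S.A₂.emb z)]
      exact congrArg conj
        (S.inner_adj ⟨_, S.half_le_dom_adj w⟩ ⟨_, S.half_le_dom z⟩).symm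
    simp only [this]
    fun_prop

/-- The restriction of `C*` to `H_{1,1/2}`, a bounded operator `H_{1,1/2} → H₂`. -/
def couplingAdj : S.A₁.Half →L[ℂ] H₂ where
  toLinearMap := S.couplingAdjLin
  cont := by
    refine continuous_of_weak S.couplingAdjLin S.C.domain S.dense_dom ?_
    intro w hw
    have : ∀ z, ⟪S.couplingAdjLin z, w⟫_ℂ = ⟪S.A₁.emb z, S.C ⟨w, hw⟩⟫_ℂ := fun z =>
      S.inner_adj ⟨_, S.half_le_dom_adj z⟩ ⟨w, hw⟩
    simp only [this]
    fun_prop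

/-- The extension `C : H₂ → H_{1,-1/2}`. -/
def couplingExt : H₂ →L[ℂ] S.A₁.Dual := S.A₁.dualMap S.couplingAdj

/-- The extension `C* : H₁ → H_{2,-1/2}`. -/
def couplingAdjExt : H₁ →L[ℂ] S.A₂.Dual := S.A₂.dualMap S.coupling

/-- `B* : H_{1,1/2} → U`. -/
def Badj : S.A₁.Half →L[ℂ] U := S.A₁.controlAdj S.B

/-- The energy space `𝓗 = H_{1,1/2} × H_{2,1/2} × H₁ × H₂`. (Its norm is the maximum of the norms of
the components, which is equivalent to the Hilbert norm of the product.) -/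
abbrev Energy : Type _ := S.A₁.Half × S.A₂.Half × H₁ × H₂

/-- `A₁ u₁ + B B* u₂ ∈ H_{1,-1/2}` for `u₁, u₂ ∈ H_{1,1/2}`. -/
def damped : S.A₁.Half × S.A₁.Half →ₗ[ℂ] S.A₁.Dual :=
  S.A₁.opExt.toLinearMap.coprod (S.B.comp S.Badj).toLinearMap

theorem damped_apply (x : S.A₁.Half × S.A₁.Half) :
    S.damped x = S.A₁.opExt x.1 + S.B (S.Badj x.2) := rfl

/-- The domain of `𝒜₁`: all `(u₁, v₁, u₂, v₂) ∈ H_{1,1/2} × H_{2,1} × H_{1,1/2} × H_{2,1/2}` such that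
`A₁ u₁ + B B* u₂ ∈ H₁`. -/
def dom1 : Submodule ℂ S.Energy where
  carrier := {X | S.A₂.emb X.2.1 ∈ S.A₂.op.domain ∧
    X.2.2.2 ∈ LinearMap.range S.A₂.emb.toLinearMap ∧
    ∃ h : X.2.2.1 ∈ LinearMap.range S.A₁.emb.toLinearMap,
      S.damped (X.1, S.A₁.lift ⟨X.2.2.1, h⟩) ∈ LinearMap.range S.A₁.toDual.toLinearMap}
  add_mem' := by
    rintro X Y ⟨h1, h2, h3, h4⟩ ⟨k1, k2, k3, k4⟩
    refine ⟨?_, add_mem h2 k2, add_mem h3 k3, ?_⟩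
    · simpa using add_mem h1 k1
    · have := add_mem h4 k4
      rw [← map_add] at this
      have e := map_add S.A₁.lift ⟨X.2.2.1, h3⟩ ⟨Y.2.2.1, k3⟩
      rw [Prod.mk_add_mk, ← e] at this
      exact this
  zero_mem' := by
    refine ⟨?_, zero_mem _, zero_mem _, ?_⟩
    · simp
    · change S.damped (0, S.A₁.lift 0) ∈ _
      rw [map_zero, show ((0 : S.A₁.Half), (0 : S.A₁.Half)) = 0 from rfl, map_zero]
      exact zero_mem _
  smul_mem' := by
    rintro c X ⟨h1, h2, h3, h4⟩
    refine ⟨?_, Submodule.smul_mem _ c h2, Submodule.smul_mem _ c h3, ?_⟩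
    · simpa using Submodule.smul_mem _ c h1
    · have := Submodule.smul_mem _ c h4
      rw [← map_smul] at this
      have e := map_smul S.A₁.lift c ⟨X.2.2.1, h3⟩
      rw [Prod.smul_mk, ← e] at this
      exact this

/-- The domain of `𝒜₂`: all `(u₁, v₁, u₂, v₂) ∈ H_{1,1/2} × H_{2,1/2} × H_{1,1/2} × H_{2,1/2}` such
that `A₁ u₁ + B B* u₂ ∈ H₁` and `C* u₁ + A₂^{1/2} v₁ ∈ H_{2,1/2}`. -/
def dom2 : Submodule ℂ S.Energy where
  carrier := {X | S.couplingAdj X.1 + S.A₂.root X.2.1 ∈ LinearMap.range S.A₂.emb.toLinearMap ∧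
    X.2.2.2 ∈ LinearMap.range S.A₂.emb.toLinearMap ∧
    ∃ h : X.2.2.1 ∈ LinearMap.range S.A₁.emb.toLinearMap,
      S.damped (X.1, S.A₁.lift ⟨X.2.2.1, h⟩) ∈ LinearMap.range S.A₁.toDual.toLinearMap}
  add_mem' := by
    rintro X Y ⟨h1, h2, h3, h4⟩ ⟨k1, k2, k3, k4⟩
    refine ⟨?_, add_mem h2 k2, add_mem h3 k3, ?_⟩
    · have := add_mem h1 k1
      rw [add_add_add_comm, ← map_add, ← map_add] at this
      exact this
    · have := add_mem h4 k4
      rw [← map_add] at this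
      have e := map_add S.A₁.lift ⟨X.2.2.1, h3⟩ ⟨Y.2.2.1, k3⟩
      rw [Prod.mk_add_mk, ← e] at this
      exact this
  zero_mem' := by
    refine ⟨?_, zero_mem _, zero_mem _, ?_⟩
    · simp only [Prod.fst_zero, Prod.snd_zero, map_zero, add_zero]
      exact zero_mem _
    · change S.damped (0, S.A₁.lift 0) ∈ _
      rw [map_zero, show ((0 : S.A₁.Half), (0 : S.A₁.Half)) = 0 from rfl, map_zero]
      exact zero_mem _
  smul_mem' := by
    rintro c X ⟨h1, h2, h3, h4⟩
    refine ⟨?_, Submodule.smul_mem _ c h2, Submodule.smul_mem _ c h3, ?_⟩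
    · have := Submodule.smul_mem _ c h1
      rw [smul_add, ← map_smul, ← map_smul] at this
      exact this
    · have := Submodule.smul_mem _ c h4
      rw [← map_smul] at this
      have e := map_smul S.A₁.lift c ⟨X.2.2.1, h3⟩
      rw [Prod.smul_mk, ← e] at this
      exact this

/-- `𝒜₁ (u₁, v₁, u₂, v₂) = (u₂, v₂, -(A₁ u₁ + B B* u₂) - C v₂, -A₂ v₁ + C* u₂)`. -/
def op1 : S.Energy →ₗ.[ℂ] S.Energy where
  domain := S.dom1
  toFun :=
    { toFun := fun X =>
        let u₁ : S.A₁.Half := X.1.1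
        let u₂ : S.A₁.Half := S.A₁.lift ⟨X.1.2.2.1, X.2.2.2.1⟩
        let v₂ : S.A₂.Half := S.A₂.lift ⟨X.1.2.2.2, X.2.2.1⟩
        (u₂, v₂,
          -S.A₁.restrict ⟨S.damped (u₁, u₂), X.2.2.2.2⟩ - S.coupling v₂,
          -S.A₂.op ⟨S.A₂.emb X.1.2.1, X.2.1⟩ + S.couplingAdj u₂)
      map_add' := by
        intro X Y
        have e₁ := map_add S.A₁.lift ⟨X.1.2.2.1, X.2.2.2.1⟩ ⟨Y.1.2.2.1, Y.2.2.2.1⟩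
        have e₂ := map_add S.A₂.lift ⟨X.1.2.2.2, X.2.2.1⟩ ⟨Y.1.2.2.2, Y.2.2.1⟩
        have e₃ := map_add S.A₁.restrict ⟨_, X.2.2.2.2⟩ ⟨_, Y.2.2.2.2⟩
        have e₄ : S.A₁.restrict ⟨_, (X + Y).2.2.2.2⟩ = _ := Eq.trans (by
          congr 1
          refine Subtype.ext ?_
          refine Eq.trans ?_ (map_add S.damped _ _)
          exact congrArg (fun z => S.damped (X.1.1 + Y.1.1, z)) e₁) e₃
        have e₅ : S.A₂.op ⟨S.A₂.emb (X + Y).1.2.1, (X + Y).2.1⟩ = _ := Eq.trans (by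
          congr 1)
          (map_add S.A₂.op.toFun ⟨_, X.2.1⟩ ⟨_, Y.2.1⟩)
        refine Prod.ext e₁ (Prod.ext e₂ (Prod.ext ?_ ?_))
        · refine (congrArg₂ (fun a b => -a - S.coupling b) e₄ e₂).trans ?_
          simp only [map_add, Prod.snd_add, Prod.fst_add]
          abel
        · refine (congrArg₂ (fun a b => -a + S.couplingAdj b) e₅ e₁).trans ?_
          simp only [map_add, Prod.snd_add, LinearPMap.toFun_eq_coe]
          abel
      map_smul' := by
        intro c X
        have e₁ := map_smul S.A₁.lift c ⟨X.1.2.2.1, X.2.2.2.1⟩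
        have e₂ := map_smul S.A₂.lift c ⟨X.1.2.2.2, X.2.2.1⟩
        have e₃ := map_smul S.A₁.restrict c ⟨_, X.2.2.2.2⟩
        have e₄ : S.A₁.restrict ⟨_, (c • X).2.2.2.2⟩ = _ := Eq.trans (by
          congr 1
          refine Subtype.ext ?_
          refine Eq.trans ?_ (map_smul S.damped c _)
          exact congrArg (fun z => S.damped (c • X.1.1, z)) e₁) e₃
        have e₅ : S.A₂.op ⟨S.A₂.emb (c • X).1.2.1, (c • X).2.1⟩ = _ := Eq.trans (by
          congr 1)
          (map_smul S.A₂.op.toFun c ⟨_, X.2.1⟩)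
        refine Prod.ext e₁ (Prod.ext e₂ (Prod.ext ?_ ?_))
        · refine (congrArg₂ (fun a b => -a - S.coupling b) e₄ e₂).trans ?_
          simp only [map_smul, Prod.smul_snd, Prod.smul_fst, RingHom.id_apply, smul_sub, smul_neg]
        · refine (congrArg₂ (fun a b => -a + S.couplingAdj b) e₅ e₁).trans ?_
          simp only [map_smul, Prod.smul_snd, RingHom.id_apply, smul_add, smul_neg,
            LinearPMap.toFun_eq_coe] }

/-- `𝒜₂ (u₁, v₁, u₂, v₂) = (u₂, v₂, -(A₁ u₁ + B B* u₂) - C (C* u₁ + A₂^{1/2} v₁),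
-A₂^{1/2} (C* u₁ + A₂^{1/2} v₁))`. -/
def op2 : S.Energy →ₗ.[ℂ] S.Energy where
  domain := S.dom2
  toFun :=
    { toFun := fun X =>
        let u₁ : S.A₁.Half := X.1.1
        let u₂ : S.A₁.Half := S.A₁.lift ⟨X.1.2.2.1, X.2.2.2.1⟩
        let v₂ : S.A₂.Half := S.A₂.lift ⟨X.1.2.2.2, X.2.2.1⟩
        let q : S.A₂.Half := S.A₂.lift ⟨S.couplingAdj u₁ + S.A₂.root X.1.2.1, X.2.1⟩
        (u₂, v₂,
          -S.A₁.restrict ⟨S.damped (u₁, u₂), X.2.2.2.2⟩ - S.coupling q,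
          -S.A₂.root q)
      map_add' := by
        intro X Y
        have e₁ := map_add S.A₁.lift ⟨X.1.2.2.1, X.2.2.2.1⟩ ⟨Y.1.2.2.1, Y.2.2.2.1⟩
        have e₂ := map_add S.A₂.lift ⟨X.1.2.2.2, X.2.2.1⟩ ⟨Y.1.2.2.2, Y.2.2.1⟩
        have e₃ := map_add S.A₁.restrict ⟨_, X.2.2.2.2⟩ ⟨_, Y.2.2.2.2⟩
        have e₄ : S.A₁.restrict ⟨_, (X + Y).2.2.2.2⟩ = _ := Eq.trans (by
          congr 1
          refine Subtype.ext ?_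
          refine Eq.trans ?_ (map_add S.damped _ _)
          exact congrArg (fun z => S.damped (X.1.1 + Y.1.1, z)) e₁) e₃
        have e₅ : S.A₂.lift ⟨_, (X + Y).2.1⟩ = _ := Eq.trans (by
          congr 1
          refine Subtype.ext (Eq.trans ?_ (add_add_add_comm _ _ _ _))
          exact congrArg₂ (· + ·) (map_add S.couplingAdj _ _) (map_add S.A₂.root _ _))
          (map_add S.A₂.lift ⟨_, X.2.1⟩ ⟨_, Y.2.1⟩)
        refine Prod.ext e₁ (Prod.ext e₂ (Prod.ext ?_ ?_))
        · refine (congrArg₂ (fun a b => -a - S.coupling b) e₄ e₅).trans ?_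
          simp only [map_add, Prod.snd_add, Prod.fst_add]
          abel
        · refine (congrArg (fun a => -S.A₂.root a) e₅).trans ?_
          simp only [map_add, Prod.snd_add]
          abel
      map_smul' := by
        intro c X
        have e₁ := map_smul S.A₁.lift c ⟨X.1.2.2.1, X.2.2.2.1⟩
        have e₂ := map_smul S.A₂.lift c ⟨X.1.2.2.2, X.2.2.1⟩
        have e₃ := map_smul S.A₁.restrict c ⟨_, X.2.2.2.2⟩
        have e₄ : S.A₁.restrict ⟨_, (c • X).2.2.2.2⟩ = _ := Eq.trans (by
          congr 1
          refine Subtype.ext ?_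
          refine Eq.trans ?_ (map_smul S.damped c _)
          exact congrArg (fun z => S.damped (c • X.1.1, z)) e₁) e₃
        have e₅ : S.A₂.lift ⟨_, (c • X).2.1⟩ = _ := Eq.trans (by
          congr 1
          refine Subtype.ext (Eq.trans ?_ (smul_add c _ _).symm)
          exact congrArg₂ (· + ·) (map_smul S.couplingAdj c _) (map_smul S.A₂.root c _))
          (map_smul S.A₂.lift c ⟨_, X.2.1⟩)
        refine Prod.ext e₁ (Prod.ext e₂ (Prod.ext ?_ ?_))
        · refine (congrArg₂ (fun a b => -a - S.coupling b) e₄ e₅).trans ?_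
          simp only [map_smul, Prod.smul_snd, Prod.smul_fst, RingHom.id_apply, smul_sub, smul_neg]
        · refine (congrArg (fun a => -S.A₂.root a) e₅).trans ?_
          simp only [map_smul, Prod.smul_snd, RingHom.id_apply, smul_neg] }

/-- The operator `P⁻¹ T P`, with domain `{X | P X ∈ D(T)}`. -/
def conjBy {E : Type*} [NormedAddCommGroup E] [NormedSpace ℂ E] (P : E ≃L[ℂ] E) (T : E →ₗ.[ℂ] E) :
    E →ₗ.[ℂ] E where
  domain := T.domain.comap P.toLinearMap
  toFun := P.symm.toLinearMap ∘ₗ T.toFun ∘ₗ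
    (P.toLinearMap ∘ₗ (T.domain.comap P.toLinearMap).subtype).codRestrict T.domain fun X => X.2

/-- A pair of functions of time with values in `H_{1,1/2}` and `H_{2,1/2}`. -/
abbrev Traj : Type _ := (ℝ≥0 → S.A₁.Half) × (ℝ≥0 → S.A₂.Half)

variable {S}

/-- The velocity of the first component, as a function with values in `H₁`. -/
def vel₁ (w : S.Traj) : ℝ≥0 → H₁ := timeDeriv fun t => S.A₁.emb (w.1 t)

/-- The velocity of the second component, as a function with values in `H₂`. -/
def vel₂ (w : S.Traj) : ℝ≥0 → H₂ := timeDeriv fun t => S.A₂.emb (w.2 t)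

/-- The state `(w₁, w₂, ẇ₁, ẇ₂)` at time `t`. -/
def state (w : S.Traj) (t : ℝ≥0) : S.Energy := (w.1 t, w.2 t, vel₁ w t, vel₂ w t)

/-- The regularity `w_i ∈ C([0,∞); H_{i,1/2}) ∩ C¹([0,∞); H_i)`. -/
structure EnergyRegular (w : S.Traj) : Prop where
  cont₁ : Continuous w.1
  cont₂ : Continuous w.2
  c1₁ : IsC1 fun t => S.A₁.emb (w.1 t)
  c1₂ : IsC1 fun t => S.A₂.emb (w.2 t)

/-- The regularity `w_i ∈ C¹([0,∞); H_{i,1/2}) ∩ C²([0,∞); H_i)`. -/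
structure ClassicalRegular (w : S.Traj) : Prop where
  half₁ : IsC1 w.1
  half₂ : IsC1 w.2
  c1₁ : IsC1 fun t => S.A₁.emb (w.1 t)
  c1₂ : IsC1 fun t => S.A₂.emb (w.2 t)
  c2₁ : IsC1 (vel₁ w)
  c2₂ : IsC1 (vel₂ w)

/-- Finite energy solutions of
`ẅ₁ + A₁ w₁ + B B* ẇ₁ + C ẇ₂ = 0`, `ẅ₂ + A₂ w₂ - C* ẇ₁ = 0`, with initial state `X₀ ∈ 𝓗`.
The equations hold in `H_{1,-1/2}` and `H_{2,-1/2}`, and `B* ẇ₁ ∈ L²_loc([0,∞); U)` is the weak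
derivative of `B* w₁ ∈ H¹_loc([0,∞); U)`. -/
structure IsEnergySol1 (X₀ : S.Energy) (w : S.Traj) : Prop where
  regular : EnergyRegular w
  initial : state w 0 = X₀
  eq₁ : ∃ g : ℝ → U, HasH1Deriv (fun t => S.Badj (w.1 t)) g ∧
    HasH1Deriv (fun t => S.A₁.toDual (vel₁ w t)) fun s =>
      -(S.A₁.opExt (timeExt w.1 s) + S.B (g s) + S.couplingExt (timeExt (vel₂ w) s))
  eq₂ : ∀ t : ℝ≥0, HasDerivWithinAt (timeExt fun t => S.A₂.toDual (vel₂ w t))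
    (-(S.A₂.opExt (w.2 t) - S.couplingAdjExt (vel₁ w t))) (Set.Ici 0) t

/-- Finite energy solutions of `ü + (A₁ + C C*) u + B B* u̇ + C A₂^{1/2} v = 0`,
`v̈ + A₂ v + A₂^{1/2} C* u = 0`, with initial state `Y₀ ∈ 𝓗`, in the same sense. -/
structure IsEnergySol2 (Y₀ : S.Energy) (u : S.Traj) : Prop where
  regular : EnergyRegular u
  initial : state u 0 = Y₀
  eq₁ : ∃ g : ℝ → U, HasH1Deriv (fun t => S.Badj (u.1 t)) g ∧
    HasH1Deriv (fun t => S.A₁.toDual (vel₁ u t)) fun s =>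
      -(S.A₁.opExt (timeExt u.1 s) + S.couplingExt (S.couplingAdj (timeExt u.1 s)) +
        S.B (g s) + S.couplingExt (S.A₂.root (timeExt u.2 s)))
  eq₂ : ∀ t : ℝ≥0, HasDerivWithinAt (timeExt fun t => S.A₂.toDual (vel₂ u t))
    (-(S.A₂.opExt (u.2 t) + S.A₂.rootExt (S.couplingAdj (u.1 t)))) (Set.Ici 0) t

/-- Classical solutions of `ẅ₁ + A₁ w₁ + B B* ẇ₁ + C ẇ₂ = 0`, `ẅ₂ + A₂ w₂ - C* ẇ₁ = 0`, with initial
state `X₀`; here `ẇ_i(t) ∈ H_{i,1/2}` for all `t`. -/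
structure IsClassicalSol1 (X₀ : S.Energy) (w : S.Traj) : Prop where
  regular : ClassicalRegular w
  initial : state w 0 = X₀
  eq₁ : ∀ t : ℝ≥0, S.A₁.toDual (timeDeriv (vel₁ w) t) + S.A₁.opExt (w.1 t) +
    S.B (S.Badj (timeDeriv w.1 t)) + S.A₁.toDual (S.coupling (timeDeriv w.2 t)) = 0
  eq₂ : ∀ t : ℝ≥0, S.A₂.toDual (timeDeriv (vel₂ w) t) + S.A₂.opExt (w.2 t) -
    S.A₂.toDual (S.couplingAdj (timeDeriv w.1 t)) = 0

/-- Classical solutions of `ü + (A₁ + C C*) u + B B* u̇ + C A₂^{1/2} v = 0`,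
`v̈ + A₂ v + A₂^{1/2} C* u = 0`, with initial state `Y₀`. -/
structure IsClassicalSol2 (Y₀ : S.Energy) (u : S.Traj) : Prop where
  regular : ClassicalRegular u
  initial : state u 0 = Y₀
  eq₁ : ∀ t : ℝ≥0, S.A₁.toDual (timeDeriv (vel₁ u) t) +
    (S.A₁.opExt (u.1 t) + S.couplingExt (S.couplingAdj (u.1 t))) +
    S.B (S.Badj (timeDeriv u.1 t)) + S.couplingExt (S.A₂.root (u.2 t)) = 0
  eq₂ : ∀ t : ℝ≥0, S.A₂.toDual (timeDeriv (vel₂ u) t) + S.A₂.opExt (u.2 t) +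
    S.A₂.rootExt (S.couplingAdj (u.1 t)) = 0

/-- `(w₁, w₂) ↦ (w₁, A₂^{-1/2} ẇ₂ - A₂^{-1/2} C* w₁)`. -/
def toUV (w : S.Traj) : S.Traj :=
  (w.1, fun t => S.A₂.root.symm (vel₂ w t) - S.A₂.root.symm (S.couplingAdj (w.1 t)))

/-- `(u, v) ↦ (u, -A₂^{-1/2} v̇)`. -/
def toW (u : S.Traj) : S.Traj := (u.1, fun t => -S.A₂.root.symm (vel₂ u t))

end CoupledSystem

end

open scoped LinearPMap InnerProductSpace ComplexConjugate NNReal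
open MeasureTheory

noncomputable section

/-! The whole statement rests on one substitution. Put `u = w₁` and `A₂^{1/2} v = ẇ₂ - C* w₁`.
Differentiating the latter in `H_{2,-1/2}` and using the second equation of (1), the terms `C* ẇ₁`
cancel and `A₂^{1/2} v̇ = -A₂ w₂` remains, that is, `v̇ = -A₂^{1/2} w₂`. This is the inverse
substitution. A further derivative gives `v̈ = -A₂^{1/2} ẇ₂ = -A₂ v - A₂^{1/2} C* u`, the second
equation of (2); inserting `ẇ₂ = A₂^{1/2} v + C* u` in the first equation of (1) gives that of (2).
The way back is the same: the second equation of (2) says that `w₂ = -A₂^{-1/2} v̇` has derivative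
`A₂^{1/2} v + C* u`.

The analytic point is that `v̇` must exist in `H₂`, while the computation takes place in
`H_{2,-1/2}`. Since `A₂^{1/2} : H₂ → H_{2,-1/2}` is bounded below (`norm_le_norm_rootExt`),
differentiability can be pulled back through it (`hasDerivWithinAt_of_rootExt`). This yields
`hasDeriv_emb_toUV` and `hasDeriv_emb_toW`, from which regularity, equations, inverse relations and
the state formula follow for both kinds of solution.

For the generators, `P` turns `C* u₁ + A₂^{1/2} v₁` into the old second velocity, and the new second
velocity is `-A₂^{1/2}` of the old displacement. The two domain conditions on the second component
are therefore exchanged, because `b ∈ D(A₂)` exactly when `A₂^{1/2} b ∈ D(A₂^{1/2})`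
(`emb_mem_domain_iff`). -/

namespace PosSelfAdjoint

/-! ### Square roots and their extensions on the scale `H_{1/2} ⊆ H ⊆ H_{-1/2}`. -/

variable {H : Type*} [NormedAddCommGroup H] [InnerProductSpace ℂ H] [CompleteSpace H]
variable (A : PosSelfAdjoint H)

theorem invSqrt_inner (x y : H) : ⟪A.invSqrt x, y⟫_ℂ = ⟪x, A.invSqrt y⟫_ℂ := by
  have h : IsSelfAdjoint A.invSqrt := (CFC.sqrt_nonneg A.inv).isSelfAdjoint
  exact (ContinuousLinearMap.isSelfAdjoint_iff_isSymmetric.1 h) x y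

theorem root_inner_emb (x z : A.Half) : ⟪A.root x, A.emb z⟫_ℂ = ⟪A.emb x, A.root z⟫_ℂ := by
  change ⟪A.root x, A.halfIncl z⟫_ℂ = ⟪A.halfIncl x, A.root z⟫_ℂ
  rw [A.halfIncl_eq, A.halfIncl_eq, invSqrt_inner]

/-- By symmetry of `A^{1/2}`, the extension really extends: tested on `z`, both functionals are the
same pairing with the root moved from one side to the other. -/
theorem rootExt_emb (x : A.Half) : A.rootExt (A.emb x) = A.toDual (A.root x) := by
  ext z
  exact A.root_inner_emb z x

theorem opExt_apply (x : A.Half) : A.opExt x = A.rootExt (A.root x) := rfl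

theorem norm_le_norm_rootExt (x : H) : ‖x‖ ≤ ‖A.rootExt x‖ := by
  rcases eq_or_ne x 0 with rfl | hx
  · simp
  have hx' : 0 < ‖x‖ := norm_pos_iff.2 hx
  -- The test vector `A^{-1/2} x` has `H_{1/2}`-norm `‖x‖`, and the functional takes the value
  -- `‖x‖²` there.
  have h := (A.rootExt x).le_opNorm (A.root.symm x)
  have e : A.rootExt x (A.root.symm x) = ⟪x, x⟫_ℂ := by
    change ⟪A.root (A.root.symm x), x⟫_ℂ = _
    rw [LinearIsometryEquiv.apply_symm_apply]
  rw [e, inner_self_eq_norm_sq_to_K, LinearIsometryEquiv.norm_map, norm_pow, RCLike.norm_ofReal,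
    abs_norm, sq] at h
  exact le_of_mul_le_mul_right h hx'

/-- The first-order remainder of `f` is bounded in norm by its image under `A^{1/2}`, so it is
little-o as soon as that image is. This recovers a derivative in `H` from one known only in
`H_{-1/2}`. -/
theorem hasDerivWithinAt_of_rootExt {f : ℝ → H} {f' : H} {s : Set ℝ} {t : ℝ}
    (h : HasDerivWithinAt (fun r => A.rootExt (f r)) (A.rootExt f') s t) :
    HasDerivWithinAt f f' s t := by
  rw [hasDerivWithinAt_iff_isLittleO] at h ⊢
  refine Asymptotics.IsBigO.trans_isLittleO (Asymptotics.IsBigO.of_bound 1 ?_) h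
  refine Filter.Eventually.of_forall fun r => ?_
  rw [one_mul]
  refine (A.norm_le_norm_rootExt _).trans_eq ?_
  rw [map_sub, map_sub]
  congr 2
  exact ((A.rootExt.restrictScalars ℝ).map_smul (r - t) f')

theorem emb_lift (x : LinearMap.range A.emb.toLinearMap) : A.emb (A.lift x) = x :=
  congrArg Subtype.val
    ((LinearEquiv.ofInjective A.emb.toLinearMap A.emb_injective).apply_symm_apply x)

theorem lift_eq {x : LinearMap.range A.emb.toLinearMap} {z : A.Half} (h : A.emb z = x) :
    A.lift x = z :=
  A.emb_injective ((A.emb_lift x).trans h.symm)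

theorem emb_eq (z : A.Half) : A.emb z = A.invSqrt (A.root z) := A.halfIncl_eq z

/-- Both directions come from `A⁻¹ = A^{-1/2} A^{-1/2}`, the operator `A` being the inverse of the
bounded `A⁻¹`. -/
theorem emb_mem_domain_iff (b : A.Half) :
    A.emb b ∈ A.op.domain ↔ A.root b ∈ LinearMap.range A.emb.toLinearMap := by
  constructor
  · intro h
    -- The preimage must be `A^{-1/2} A b`; applying the injective `A^{-1/2}` reduces the claim to
    -- `A⁻¹ A b = b`.
    refine ⟨A.root.symm (A.op ⟨_, h⟩), A.invSqrt_injective ?_⟩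
    change A.invSqrt (A.emb _) = _
    rw [← emb_eq, emb_eq, LinearIsometryEquiv.apply_symm_apply]
    change (A.invSqrt * A.invSqrt) _ = _
    rw [invSqrt_mul_self]
    exact congrArg Subtype.val (A.opEquiv.symm_apply_apply ⟨_, h⟩)
  · rintro ⟨z, hz⟩
    change A.emb z = _ at hz
    rw [emb_eq, ← hz, emb_eq]
    change (A.invSqrt * A.invSqrt) _ ∈ _
    rw [invSqrt_mul_self]
    exact (A.opEquiv.symm (A.root z)).2

theorem op_emb (b : A.Half) (h : A.emb b ∈ A.op.domain)
    (h' : A.root b ∈ LinearMap.range A.emb.toLinearMap) :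
    A.op ⟨A.emb b, h⟩ = A.root (A.lift ⟨A.root b, h'⟩) := by
  have e : (⟨A.emb b, h⟩ : A.op.domain) = A.opEquiv.symm (A.root (A.lift ⟨A.root b, h'⟩)) := by
    refine Subtype.ext ?_
    change A.emb b = A.inv _
    rw [← invSqrt_mul_self]
    change _ = A.invSqrt (A.invSqrt _)
    rw [← emb_eq, emb_lift, ← emb_eq]
  rw [e]
  exact A.opEquiv.apply_symm_apply _

end PosSelfAdjoint

/-! ### Calculus on `[0, ∞)`. -/

section Time

variable {E F : Type*} [NormedAddCommGroup E] [NormedSpace ℂ E] [NormedAddCommGroup F]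
  [NormedSpace ℂ F]

theorem timeDeriv_eq {f : ℝ≥0 → E} {f' : E} {t : ℝ≥0}
    (h : HasDerivWithinAt (timeExt f) f' (Set.Ici 0) t) : timeDeriv f t = f' :=
  h.derivWithin (uniqueDiffOn_Ici 0 _ t.2)

theorem IsC1.hasDeriv {f : ℝ≥0 → E} (h : IsC1 f) (t : ℝ≥0) :
    HasDerivWithinAt (timeExt f) (timeDeriv f t) (Set.Ici 0) t :=
  (h.diff t).hasDerivWithinAt

theorem isC1_of_hasDeriv {f f' : ℝ≥0 → E} (hf' : Continuous f')
    (h : ∀ t : ℝ≥0, HasDerivWithinAt (timeExt f) (f' t) (Set.Ici 0) t) : IsC1 f where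
  diff t := (h t).differentiableWithinAt
  cont := by
    rw [show timeDeriv f = f' from funext fun t => timeDeriv_eq (h t)]
    exact hf'

theorem HasDerivWithinAt.clm_timeExt (L : E →L[ℂ] F) {f : ℝ≥0 → E} {f' : E} {s : Set ℝ} {t : ℝ}
    (h : HasDerivWithinAt (timeExt f) f' s t) :
    HasDerivWithinAt (timeExt fun r => L (f r)) (L f') s t :=
  -- Time is real, so the chain rule needs `L` as a real-linear map.
  (L.restrictScalars ℝ).hasFDerivAt.comp_hasDerivWithinAt t h

theorem IsC1.clm {f : ℝ≥0 → E} (h : IsC1 f) (L : E →L[ℂ] F) : IsC1 fun t => L (f t) :=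
  isC1_of_hasDeriv (L.continuous.comp h.cont) fun t => (h.hasDeriv t).clm_timeExt L

theorem IsC1.timeDeriv_clm {f : ℝ≥0 → E} (h : IsC1 f) (L : E →L[ℂ] F) (t : ℝ≥0) :
    timeDeriv (fun t => L (f t)) t = L (timeDeriv f t) :=
  timeDeriv_eq ((h.hasDeriv t).clm_timeExt L)

theorem IsC1.add {f g : ℝ≥0 → E} (hf : IsC1 f) (hg : IsC1 g) : IsC1 fun t => f t + g t :=
  isC1_of_hasDeriv (hf.cont.add hg.cont) fun t => (hf.hasDeriv t).add (hg.hasDeriv t)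

theorem IsC1.neg {f : ℝ≥0 → E} (hf : IsC1 f) : IsC1 fun t => -f t :=
  isC1_of_hasDeriv hf.cont.neg fun t => (hf.hasDeriv t).neg

theorem IsC1.sub {f g : ℝ≥0 → E} (hf : IsC1 f) (hg : IsC1 g) : IsC1 fun t => f t - g t :=
  isC1_of_hasDeriv (hf.cont.sub hg.cont) fun t => (hf.hasDeriv t).sub (hg.hasDeriv t)

end Time

/-! ### Compatibility of the coupling operators with their extensions. -/

namespace CoupledSystem

variable {H₁ H₂ U : Type*}
  [NormedAddCommGroup H₁] [InnerProductSpace ℂ H₁] [CompleteSpace H₁]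
  [NormedAddCommGroup H₂] [InnerProductSpace ℂ H₂] [CompleteSpace H₂]
  [NormedAddCommGroup U] [InnerProductSpace ℂ U] [CompleteSpace U]
variable (S : CoupledSystem H₁ H₂ U)

theorem couplingAdj_inner (x : S.A₁.Half) (y : S.A₂.Half) :
    ⟪S.couplingAdj x, S.A₂.emb y⟫_ℂ = ⟪S.A₁.emb x, S.coupling y⟫_ℂ :=
  S.inner_adj ⟨_, S.half_le_dom_adj x⟩ ⟨_, S.half_le_dom y⟩

theorem couplingExt_emb (y : S.A₂.Half) :
    S.couplingExt (S.A₂.emb y) = S.A₁.toDual (S.coupling y) := by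
  ext x
  exact S.couplingAdj_inner x y

theorem couplingAdjExt_emb (x : S.A₁.Half) :
    S.couplingAdjExt (S.A₁.emb x) = S.A₂.toDual (S.couplingAdj x) := by
  ext y
  change ⟪S.coupling y, S.A₁.emb x⟫_ℂ = ⟪S.A₂.emb y, S.couplingAdj x⟫_ℂ
  rw [← inner_conj_symm, ← S.couplingAdj_inner, inner_conj_symm]

/-! ### The transformation `P` and the similarity of the generators. -/

/-- `P (a, b, c, d) = (a, -A₂^{-1/2} C* a + A₂^{-1/2} d, c, -A₂^{1/2} b)` as an automorphism of the
energy space. -/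
def transform : S.Energy ≃L[ℂ] S.Energy where
  toFun X := (X.1, -S.A₂.root.symm (S.couplingAdj X.1) + S.A₂.root.symm X.2.2.2, X.2.2.1,
    -S.A₂.root X.2.1)
  invFun Y := (Y.1, -S.A₂.root.symm Y.2.2.2, Y.2.2.1, S.couplingAdj Y.1 + S.A₂.root Y.2.1)
  map_add' X Y := by
    refine Prod.ext rfl (Prod.ext ?_ (Prod.ext rfl ?_)) <;>
      simp only [Prod.fst_add, Prod.snd_add, map_add] <;> abel
  map_smul' c X := by
    refine Prod.ext rfl (Prod.ext ?_ (Prod.ext rfl ?_)) <;>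
      simp only [Prod.smul_fst, Prod.smul_snd, map_smul, smul_add, smul_neg, RingHom.id_apply]
  left_inv X := by
    refine Prod.ext rfl (Prod.ext ?_ (Prod.ext rfl ?_)) <;> simp
  right_inv X := by
    refine Prod.ext rfl (Prod.ext ?_ (Prod.ext rfl ?_)) <;> simp
  continuous_toFun := by
    have h := S.A₂.root.continuous
    have h' := S.A₂.root.symm.continuous
    fun_prop
  continuous_invFun := by
    have h := S.A₂.root.continuous
    have h' := S.A₂.root.symm.continuous
    fun_prop

theorem transform_apply (X : S.Energy) : S.transform X =
    (X.1, -S.A₂.root.symm (S.couplingAdj X.1) + S.A₂.root.symm X.2.2.2, X.2.2.1,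
      -S.A₂.root X.2.1) := rfl

theorem transform_symm_apply (Y : S.Energy) : S.transform.symm Y =
    (Y.1, -S.A₂.root.symm Y.2.2.2, Y.2.2.1, S.couplingAdj Y.1 + S.A₂.root Y.2.1) := rfl

theorem couplingAdj_add_root_transform (X : S.Energy) :
    S.couplingAdj (S.transform X).1 + S.A₂.root (S.transform X).2.1 = X.2.2.2 := by
  simp [transform_apply]

theorem transform_mem_dom2_iff (X : S.Energy) : S.transform X ∈ S.dom2 ↔ X ∈ S.dom1 := by
  change (S.couplingAdj (S.transform X).1 + S.A₂.root (S.transform X).2.1 ∈ _ ∧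
    -S.A₂.root X.2.1 ∈ _ ∧ _) ↔ (_ ∧ _ ∧ _)
  rw [couplingAdj_add_root_transform, S.A₂.emb_mem_domain_iff, Submodule.neg_mem_iff]
  -- The conditions on the second displacement and the second velocity change places; the condition
  -- on `A₁ u₁ + B B* u₂` is untouched.
  exact and_left_comm

theorem op1_eq_conjBy : S.op1 = conjBy S.transform S.op2 := by
  refine LinearPMap.ext (Submodule.ext fun X => (S.transform_mem_dom2_iff X).symm) ?_
  intro X hX hX'
  have hd := hX.2.1
  have hr := (S.A₂.emb_mem_domain_iff X.2.1).1 hX.1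
  -- The auxiliary `q = C* u₁ + A₂^{1/2} v₁` of `𝒜₂`, evaluated at `P X`, is the second velocity of
  -- `X`.
  have eq : S.A₂.lift ⟨_, (show S.transform X ∈ S.dom2 from hX').1⟩ =
      S.A₂.lift ⟨X.2.2.2, hd⟩ := by
    congr 1
    exact Subtype.ext (S.couplingAdj_add_root_transform X)
  have ev : S.A₂.lift ⟨_, (show S.transform X ∈ S.dom2 from hX').2.1⟩ =
      -S.A₂.lift ⟨S.A₂.root X.2.1, hr⟩ := by
    refine S.A₂.lift_eq ?_
    rw [map_neg, S.A₂.emb_lift]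
    rfl
  let u₂ : S.A₁.Half := S.A₁.lift ⟨X.2.2.1, hX.2.2.1⟩
  refine Prod.ext rfl (Prod.ext ?_ (Prod.ext ?_ ?_))
  · refine Eq.symm ((congrArg (fun q => -S.A₂.root.symm (-S.A₂.root q)) eq).trans ?_)
    simp only [map_neg, neg_neg, LinearIsometryEquiv.symm_apply_apply]
    rfl
  · exact (congrArg (fun q => -S.A₁.restrict ⟨S.damped (X.1, u₂), hX.2.2.2⟩ - S.coupling q) eq).symm
  · refine (congrArg (fun a => -a + S.couplingAdj u₂) (S.A₂.op_emb _ hX.1 hr)).trans ?_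
    refine Eq.trans ?_ (congrArg (fun q => S.couplingAdj u₂ + S.A₂.root q) ev).symm
    rw [map_neg, add_comm]

/-! ### The substitution and its derivative identities. -/

variable {S}

theorem root_toUV (w : S.Traj) (t : ℝ≥0) :
    S.A₂.root ((toUV w).2 t) = vel₂ w t - S.couplingAdj (w.1 t) := by
  change S.A₂.root (S.A₂.root.symm _ - S.A₂.root.symm _) = _
  simp

theorem root_toW (u : S.Traj) (t : ℝ≥0) : S.A₂.root ((toW u).2 t) = -vel₂ u t := by
  change S.A₂.root (-S.A₂.root.symm _) = _
  simp

/-- This is `v̇ = -A₂^{1/2} w₂`, using only energy regularity of `w₁`: `C* w₁` is differentiated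
through the extension of `C*` to `H₁`, its derivative cancels the coupling term of the equation, and
the remaining `-A₂ w₂` lies in the image of `A₂^{1/2}`. -/
theorem hasDeriv_emb_toUV {w : S.Traj} (h₁ : IsC1 fun t => S.A₁.emb (w.1 t))
    (h₂ : ∀ t : ℝ≥0, HasDerivWithinAt (timeExt fun t => S.A₂.toDual (vel₂ w t))
      (-(S.A₂.opExt (w.2 t) - S.couplingAdjExt (vel₁ w t))) (Set.Ici 0) t) (t : ℝ≥0) :
    HasDerivWithinAt (timeExt fun t => S.A₂.emb ((toUV w).2 t)) (-S.A₂.root (w.2 t))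
      (Set.Ici 0) t := by
  refine S.A₂.hasDerivWithinAt_of_rootExt ?_
  have h := (h₂ t).sub ((h₁.hasDeriv t).clm_timeExt S.couplingAdjExt)
  have e : (fun r => S.A₂.rootExt (timeExt (fun t => S.A₂.emb ((toUV w).2 t)) r)) =
      (timeExt fun t => S.A₂.toDual (vel₂ w t)) -
        timeExt fun t => S.couplingAdjExt (S.A₁.emb (w.1 t)) := by
    funext r
    change S.A₂.rootExt (S.A₂.emb _) = S.A₂.toDual _ - S.couplingAdjExt (S.A₁.emb _)
    rw [S.A₂.rootExt_emb, root_toUV, S.couplingAdjExt_emb, map_sub]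
  rw [e]
  refine h.congr_deriv ?_
  change -(_ - S.couplingAdjExt (vel₁ w t)) - S.couplingAdjExt (vel₁ w t) = _
  rw [S.A₂.opExt_apply, map_neg]
  abel

/-- Here `A₂^{1/2} w₂ = -v̇`, and the right-hand side of the second equation factors as `A₂^{1/2}`
applied to `A₂^{1/2} v + C* u`, so the root can be cancelled. -/
theorem hasDeriv_emb_toW {u : S.Traj}
    (h₂ : ∀ t : ℝ≥0, HasDerivWithinAt (timeExt fun t => S.A₂.toDual (vel₂ u t))
      (-(S.A₂.opExt (u.2 t) + S.A₂.rootExt (S.couplingAdj (u.1 t)))) (Set.Ici 0) t) (t : ℝ≥0) :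
    HasDerivWithinAt (timeExt fun t => S.A₂.emb ((toW u).2 t))
      (S.A₂.root (u.2 t) + S.couplingAdj (u.1 t)) (Set.Ici 0) t := by
  refine S.A₂.hasDerivWithinAt_of_rootExt ?_
  have e : (fun r => S.A₂.rootExt (timeExt (fun t => S.A₂.emb ((toW u).2 t)) r)) =
      -timeExt fun t => S.A₂.toDual (vel₂ u t) := by
    funext r
    change S.A₂.rootExt (S.A₂.emb _) = -S.A₂.toDual _
    rw [S.A₂.rootExt_emb, root_toW, map_neg]
  rw [e]
  refine (h₂ t).neg.congr_deriv ?_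
  rw [S.A₂.opExt_apply, map_add, neg_neg]

/-- Only the derivative identity enters, so this lemma and the next three serve energy and classical
solutions alike. -/
theorem toW_toUV {w : S.Traj} (h : vel₂ (toUV w) = fun t => -S.A₂.root (w.2 t)) :
    toW (toUV w) = w := by
  refine Prod.ext rfl (funext fun t => ?_)
  change -S.A₂.root.symm (vel₂ (toUV w) t) = _
  rw [h]
  simp

theorem toUV_toW {u : S.Traj}
    (h : vel₂ (toW u) = fun t => S.A₂.root (u.2 t) + S.couplingAdj (u.1 t)) :
    toUV (toW u) = u := by
  refine Prod.ext rfl (funext fun t => ?_)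
  change S.A₂.root.symm (vel₂ (toW u) t) - S.A₂.root.symm (S.couplingAdj (u.1 t)) = _
  rw [h]
  simp

theorem state_toUV {w : S.Traj} (h : vel₂ (toUV w) = fun t => -S.A₂.root (w.2 t)) (t : ℝ≥0) :
    state (toUV w) t = S.transform (state w t) := by
  refine Prod.ext rfl (Prod.ext ?_ (Prod.ext rfl (congrFun h t)))
  exact sub_eq_neg_add _ _

theorem state_toW {u : S.Traj}
    (h : vel₂ (toW u) = fun t => S.A₂.root (u.2 t) + S.couplingAdj (u.1 t)) (t : ℝ≥0) :
    state (toW u) t = S.transform.symm (state u t) := by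
  refine Prod.ext rfl (Prod.ext rfl (Prod.ext rfl ((congrFun h t).trans ?_)))
  exact add_comm _ _

/-! ### Energy solutions. -/

theorem IsEnergySol1.vel₂_toUV {X : S.Energy} {w : S.Traj} (h : IsEnergySol1 X w) :
    vel₂ (toUV w) = fun t => -S.A₂.root (w.2 t) :=
  funext fun t => timeDeriv_eq (hasDeriv_emb_toUV h.regular.c1₁ h.eq₂ t)

theorem IsEnergySol2.vel₂_toW {Y : S.Energy} {u : S.Traj} (h : IsEnergySol2 Y u) :
    vel₂ (toW u) = fun t => S.A₂.root (u.2 t) + S.couplingAdj (u.1 t) :=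
  funext fun t => timeDeriv_eq (hasDeriv_emb_toW h.eq₂ t)

/-- Regularity is traded across `A₂^{1/2}`: continuity of `ẇ₂` in `H₂` gives continuity of `v` in
`H_{2,1/2}`, and continuity of `w₂` in `H_{2,1/2}` gives continuity of `v̇` in `H₂`. -/
theorem IsEnergySol1.toUV {X : S.Energy} {w : S.Traj} (h : IsEnergySol1 X w) :
    IsEnergySol2 (S.transform X) (toUV w) where
  regular :=
    { cont₁ := h.regular.cont₁
      cont₂ := (S.A₂.root.symm.continuous.comp h.regular.c1₂.cont).sub
        (S.A₂.root.symm.continuous.comp (S.couplingAdj.continuous.comp h.regular.cont₁))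
      c1₁ := h.regular.c1₁
      c1₂ := isC1_of_hasDeriv (S.A₂.root.continuous.comp h.regular.cont₂).neg
        (hasDeriv_emb_toUV h.regular.c1₁ h.eq₂) }
  initial := by rw [state_toUV h.vel₂_toUV, h.initial]
  eq₁ := by
    obtain ⟨g, hg, hw⟩ := h.eq₁
    -- The first component is unchanged, so the same weak derivative of `B* w₁` serves, and the two
    -- integrands agree at every time.
    refine ⟨g, hg, ?_⟩
    refine (congrArg (HasH1Deriv fun t => S.A₁.toDual (vel₁ w t)) (funext fun s => ?_)).mp hw
    refine congrArg Neg.neg (Eq.symm ?_)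
    change _ + S.couplingExt (S.couplingAdj (w.1 s.toNNReal)) + _ +
      S.couplingExt (S.A₂.root ((CoupledSystem.toUV w).2 s.toNNReal)) =
        _ + S.couplingExt (vel₂ w s.toNNReal)
    rw [root_toUV, map_sub]
    change S.A₁.opExt (w.1 s.toNNReal) + _ + _ + _ = S.A₁.opExt (w.1 s.toNNReal) + _ + _
    abel
  eq₂ t := by
    rw [h.vel₂_toUV]
    -- As `w₂` is only C¹ into `H₂`, `A₂^{1/2} w₂` is differentiated in `H_{2,-1/2}`, through the
    -- extended root.
    have e : (timeExt fun t => S.A₂.toDual (-S.A₂.root (w.2 t))) =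
        timeExt fun t => (-S.A₂.rootExt) (S.A₂.emb (w.2 t)) := by
      funext r
      change S.A₂.toDual (-S.A₂.root _) = -S.A₂.rootExt (S.A₂.emb _)
      rw [S.A₂.rootExt_emb, map_neg]
    rw [e]
    refine ((h.regular.c1₂.hasDeriv t).clm_timeExt (-S.A₂.rootExt)).congr_deriv ?_
    change -S.A₂.rootExt (vel₂ w t) = -(_ + S.A₂.rootExt (S.couplingAdj (w.1 t)))
    rw [S.A₂.opExt_apply, root_toUV, map_sub, sub_add_cancel]

theorem IsEnergySol2.toW {Y : S.Energy} {u : S.Traj} (h : IsEnergySol2 Y u) :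
    IsEnergySol1 (S.transform.symm Y) (toW u) where
  regular :=
    { cont₁ := h.regular.cont₁
      cont₂ := (S.A₂.root.symm.continuous.comp h.regular.c1₂.cont).neg
      c1₁ := h.regular.c1₁
      c1₂ := isC1_of_hasDeriv ((S.A₂.root.continuous.comp h.regular.cont₂).add
        (S.couplingAdj.continuous.comp h.regular.cont₁)) (hasDeriv_emb_toW h.eq₂) }
  initial := by rw [state_toW h.vel₂_toW, h.initial]
  eq₁ := by
    obtain ⟨g, hg, hu⟩ := h.eq₁
    refine ⟨g, hg, ?_⟩
    refine (congrArg (HasH1Deriv fun t => S.A₁.toDual (vel₁ u t)) (funext fun s => ?_)).mp hu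
    refine congrArg Neg.neg (Eq.symm ?_)
    rw [h.vel₂_toW]
    change _ + S.couplingExt (S.A₂.root (u.2 s.toNNReal) + S.couplingAdj (u.1 s.toNNReal)) =
      _ + S.couplingExt (S.couplingAdj (u.1 s.toNNReal)) + _ +
        S.couplingExt (S.A₂.root (u.2 s.toNNReal))
    rw [map_add]
    change S.A₁.opExt (u.1 s.toNNReal) + _ + _ = S.A₁.opExt (u.1 s.toNNReal) + _ + _ + _
    abel
  eq₂ t := by
    rw [h.vel₂_toW]
    have e : (timeExt fun t => S.A₂.toDual (S.A₂.root (u.2 t) + S.couplingAdj (u.1 t))) =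
        (timeExt fun t => S.A₂.rootExt (S.A₂.emb (u.2 t))) +
          timeExt fun t => S.couplingAdjExt (S.A₁.emb (u.1 t)) := by
      funext r
      change S.A₂.toDual (S.A₂.root _ + S.couplingAdj _) =
        S.A₂.rootExt (S.A₂.emb _) + S.couplingAdjExt (S.A₁.emb _)
      rw [S.A₂.rootExt_emb, S.couplingAdjExt_emb, map_add]
    rw [e]
    refine (((h.regular.c1₂.hasDeriv t).clm_timeExt S.A₂.rootExt).add
      ((h.regular.c1₁.hasDeriv t).clm_timeExt S.couplingAdjExt)).congr_deriv ?_
    change S.A₂.rootExt (vel₂ u t) + S.couplingAdjExt (vel₁ u t) =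
      -(_ - S.couplingAdjExt (vel₁ u t))
    rw [S.A₂.opExt_apply, root_toW, map_neg]
    abel

/-! ### Classical solutions. -/

theorem ClassicalRegular.vel₁_eq {w : S.Traj} (h : ClassicalRegular w) (t : ℝ≥0) :
    vel₁ w t = S.A₁.emb (timeDeriv w.1 t) :=
  h.half₁.timeDeriv_clm S.A₁.emb t

theorem ClassicalRegular.vel₂_eq {w : S.Traj} (h : ClassicalRegular w) (t : ℝ≥0) :
    vel₂ w t = S.A₂.emb (timeDeriv w.2 t) :=
  h.half₂.timeDeriv_clm S.A₂.emb t

/-- Puts the classical second equation in the form used for energy solutions, so that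
`hasDeriv_emb_toUV` applies. -/
theorem IsClassicalSol1.hasDeriv_vel₂ {X : S.Energy} {w : S.Traj} (h : IsClassicalSol1 X w)
    (t : ℝ≥0) : HasDerivWithinAt (timeExt fun t => S.A₂.toDual (vel₂ w t))
      (-(S.A₂.opExt (w.2 t) - S.couplingAdjExt (vel₁ w t))) (Set.Ici 0) t := by
  refine ((h.regular.c2₂.hasDeriv t).clm_timeExt S.A₂.toDual).congr_deriv ?_
  rw [h.regular.vel₁_eq, S.couplingAdjExt_emb]
  refine eq_neg_of_add_eq_zero_left ?_
  rw [← h.eq₂ t]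
  abel

theorem IsClassicalSol2.hasDeriv_vel₂ {Y : S.Energy} {u : S.Traj} (h : IsClassicalSol2 Y u)
    (t : ℝ≥0) : HasDerivWithinAt (timeExt fun t => S.A₂.toDual (vel₂ u t))
      (-(S.A₂.opExt (u.2 t) + S.A₂.rootExt (S.couplingAdj (u.1 t)))) (Set.Ici 0) t := by
  refine ((h.regular.c2₂.hasDeriv t).clm_timeExt S.A₂.toDual).congr_deriv ?_
  refine eq_neg_of_add_eq_zero_left ?_
  rw [← h.eq₂ t]
  abel

theorem IsClassicalSol1.vel₂_toUV {X : S.Energy} {w : S.Traj} (h : IsClassicalSol1 X w) :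
    vel₂ (toUV w) = fun t => -S.A₂.root (w.2 t) :=
  funext fun t => timeDeriv_eq (hasDeriv_emb_toUV h.regular.c1₁ h.hasDeriv_vel₂ t)

theorem IsClassicalSol2.vel₂_toW {Y : S.Energy} {u : S.Traj} (h : IsClassicalSol2 Y u) :
    vel₂ (toW u) = fun t => S.A₂.root (u.2 t) + S.couplingAdj (u.1 t) :=
  funext fun t => timeDeriv_eq (hasDeriv_emb_toW h.hasDeriv_vel₂ t)

/-- The trade of regularity is one order higher: `ẇ₂` being C¹ in `H₂` makes `v` C¹ in `H_{2,1/2}`,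
and `w₂` being C¹ in `H_{2,1/2}` makes `v̇` C¹ in `H₂`. -/
theorem IsClassicalSol1.toUV {X : S.Energy} {w : S.Traj} (h : IsClassicalSol1 X w) :
    IsClassicalSol2 (S.transform X) (toUV w) where
  regular :=
    have hv : IsC1 (CoupledSystem.toUV w).2 :=
      (h.regular.c2₂.clm (S.A₂.root.symm : H₂ →L[ℂ] S.A₂.Half)).sub
        ((h.regular.half₁.clm S.couplingAdj).clm (S.A₂.root.symm : H₂ →L[ℂ] S.A₂.Half))
    { half₁ := h.regular.half₁
      half₂ := hv
      c1₁ := h.regular.c1₁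
      c1₂ := hv.clm S.A₂.emb
      c2₁ := h.regular.c2₁
      c2₂ := by
        rw [h.vel₂_toUV]
        exact (h.regular.half₂.clm (S.A₂.root : S.A₂.Half →L[ℂ] H₂)).neg }
  initial := by rw [state_toUV h.vel₂_toUV, h.initial]
  eq₁ t := by
    rw [root_toUV, map_sub, h.regular.vel₂_eq, S.couplingExt_emb, ← h.eq₁ t]
    change S.A₁.toDual (timeDeriv (vel₁ w) t) + (S.A₁.opExt (w.1 t) +
      S.couplingExt (S.couplingAdj (w.1 t))) + S.B (S.Badj (timeDeriv w.1 t)) +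
        (_ - S.couplingExt (S.couplingAdj (w.1 t))) = _
    abel
  eq₂ t := by
    have e : timeDeriv (fun t => -S.A₂.root (w.2 t)) t = -S.A₂.root (timeDeriv w.2 t) :=
      h.regular.half₂.timeDeriv_clm (-(S.A₂.root : S.A₂.Half →L[ℂ] H₂)) t
    rw [h.vel₂_toUV, e, S.A₂.opExt_apply, root_toUV, map_sub, h.regular.vel₂_eq, S.A₂.rootExt_emb,
      map_neg]
    change _ + (_ - S.A₂.rootExt (S.couplingAdj (w.1 t))) +
      S.A₂.rootExt (S.couplingAdj (w.1 t)) = 0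
    abel

theorem IsClassicalSol2.toW {Y : S.Energy} {u : S.Traj} (h : IsClassicalSol2 Y u) :
    IsClassicalSol1 (S.transform.symm Y) (toW u) where
  regular :=
    have hw : IsC1 (CoupledSystem.toW u).2 :=
      (h.regular.c2₂.clm (S.A₂.root.symm : H₂ →L[ℂ] S.A₂.Half)).neg
    { half₁ := h.regular.half₁
      half₂ := hw
      c1₁ := h.regular.c1₁
      c1₂ := hw.clm S.A₂.emb
      c2₁ := h.regular.c2₁
      c2₂ := by
        rw [h.vel₂_toW]
        exact (h.regular.half₂.clm (S.A₂.root : S.A₂.Half →L[ℂ] H₂)).add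
          (h.regular.half₁.clm S.couplingAdj) }
  initial := by rw [state_toW h.vel₂_toW, h.initial]
  eq₁ t := by
    have hw : IsC1 (CoupledSystem.toW u).2 :=
      (h.regular.c2₂.clm (S.A₂.root.symm : H₂ →L[ℂ] S.A₂.Half)).neg
    have e : S.A₂.emb (timeDeriv (CoupledSystem.toW u).2 t) = _ :=
      (hw.timeDeriv_clm S.A₂.emb t).symm.trans (congrFun h.vel₂_toW t)
    -- The term `C ẇ₂` is moved to `H_{1,-1/2}` before splitting, where `C C* u` and `C A₂^{1/2} v`
    -- make sense separately.
    rw [← S.couplingExt_emb, e, map_add, ← h.eq₁ t]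
    change S.A₁.toDual (timeDeriv (vel₁ u) t) + S.A₁.opExt (u.1 t) +
      S.B (S.Badj (timeDeriv u.1 t)) + _ = _
    abel
  eq₂ t := by
    have e : timeDeriv (fun t => S.A₂.root (u.2 t) + S.couplingAdj (u.1 t)) t =
        S.A₂.root (timeDeriv u.2 t) + S.couplingAdj (timeDeriv u.1 t) :=
      timeDeriv_eq (((h.regular.half₂.hasDeriv t).clm_timeExt
        (S.A₂.root : S.A₂.Half →L[ℂ] H₂)).add
          ((h.regular.half₁.hasDeriv t).clm_timeExt S.couplingAdj))
    rw [h.vel₂_toW, e, S.A₂.opExt_apply, root_toW, map_neg, h.regular.vel₂_eq, S.A₂.rootExt_emb,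
      map_add]
    change _ + S.A₂.toDual (S.couplingAdj (timeDeriv u.1 t)) + _ -
      S.A₂.toDual (S.couplingAdj (timeDeriv u.1 t)) = 0
    abel

end CoupledSystem

end

/-! ### The theorem. -/

theorem theorem3p1 {H₁ H₂ U : Type*}
    [NormedAddCommGroup H₁] [InnerProductSpace ℂ H₁] [CompleteSpace H₁]
    [NormedAddCommGroup H₂] [InnerProductSpace ℂ H₂] [CompleteSpace H₂]
    [NormedAddCommGroup U] [InnerProductSpace ℂ U] [CompleteSpace U]
    (S : CoupledSystem H₁ H₂ U) :
    ∃ P : S.Energy ≃L[ℂ] S.Energy,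
      (∀ X : S.Energy, P X =
        (X.1, -S.A₂.root.symm (S.couplingAdj X.1) + S.A₂.root.symm X.2.2.2, X.2.2.1,
          -S.A₂.root X.2.1)) ∧
      (∀ Y : S.Energy, P.symm Y =
        (Y.1, -S.A₂.root.symm Y.2.2.2, Y.2.2.1, S.couplingAdj Y.1 + S.A₂.root Y.2.1)) ∧
      S.op1 = CoupledSystem.conjBy P S.op2 ∧
      (∀ X₀ : S.Energy,
        Set.BijOn CoupledSystem.toUV {w : S.Traj | CoupledSystem.IsEnergySol1 X₀ w} {u | CoupledSystem.IsEnergySol2 (P X₀) u} ∧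
        Set.MapsTo CoupledSystem.toW {u : S.Traj | CoupledSystem.IsEnergySol2 (P X₀) u} {w | CoupledSystem.IsEnergySol1 X₀ w} ∧
        Set.InvOn CoupledSystem.toW CoupledSystem.toUV {w : S.Traj | CoupledSystem.IsEnergySol1 X₀ w} {u | CoupledSystem.IsEnergySol2 (P X₀) u} ∧
        ∀ w : S.Traj, CoupledSystem.IsEnergySol1 X₀ w → ∀ t, CoupledSystem.state (CoupledSystem.toUV w) t = P (CoupledSystem.state w t)) ∧
      (∀ X₀ : S.Energy,
        Set.BijOn CoupledSystem.toUV {w : S.Traj | CoupledSystem.IsClassicalSol1 X₀ w} {u | CoupledSystem.IsClassicalSol2 (P X₀) u} ∧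
        Set.MapsTo CoupledSystem.toW {u : S.Traj | CoupledSystem.IsClassicalSol2 (P X₀) u} {w | CoupledSystem.IsClassicalSol1 X₀ w} ∧
        Set.InvOn CoupledSystem.toW CoupledSystem.toUV {w : S.Traj | CoupledSystem.IsClassicalSol1 X₀ w} {u | CoupledSystem.IsClassicalSol2 (P X₀) u} ∧
        ∀ w : S.Traj, CoupledSystem.IsClassicalSol1 X₀ w → ∀ t, CoupledSystem.state (CoupledSystem.toUV w) t = P (CoupledSystem.state w t)) := by
  refine ⟨S.transform, S.transform_apply, S.transform_symm_apply, S.op1_eq_conjBy,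
    fun X₀ => ?_, fun X₀ => ?_⟩
  · have hW : Set.MapsTo CoupledSystem.toW
        {u : S.Traj | CoupledSystem.IsEnergySol2 (S.transform X₀) u}
        {w | CoupledSystem.IsEnergySol1 X₀ w} := fun u hu => by
      simpa only [Set.mem_ofPred_eq, ContinuousLinearEquiv.symm_apply_apply] using hu.toW
    have hInv : Set.InvOn CoupledSystem.toW CoupledSystem.toUV
        {w : S.Traj | CoupledSystem.IsEnergySol1 X₀ w}
        {u | CoupledSystem.IsEnergySol2 (S.transform X₀) u} :=
      ⟨fun w hw => CoupledSystem.toW_toUV hw.vel₂_toUV,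
        fun u hu => CoupledSystem.toUV_toW hu.vel₂_toW⟩
    -- Two maps between the solution sets that are inverse to each other there are bijections, so
    -- injectivity and surjectivity need no separate argument.
    exact ⟨hInv.bijOn (fun w hw => hw.toUV) hW, hW, hInv,
      fun w hw => CoupledSystem.state_toUV hw.vel₂_toUV⟩
  · have hW : Set.MapsTo CoupledSystem.toW
        {u : S.Traj | CoupledSystem.IsClassicalSol2 (S.transform X₀) u}
        {w | CoupledSystem.IsClassicalSol1 X₀ w} := fun u hu => by
      simpa only [Set.mem_ofPred_eq, ContinuousLinearEquiv.symm_apply_apply] using hu.toW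
    have hInv : Set.InvOn CoupledSystem.toW CoupledSystem.toUV
        {w : S.Traj | CoupledSystem.IsClassicalSol1 X₀ w}
        {u | CoupledSystem.IsClassicalSol2 (S.transform X₀) u} :=
      ⟨fun w hw => CoupledSystem.toW_toUV hw.vel₂_toUV,
        fun u hu => CoupledSystem.toUV_toW hu.vel₂_toW⟩
    exact ⟨hInv.bijOn (fun w hw => hw.toUV) hW, hW, hInv,
      fun w hw => CoupledSystem.state_toUV hw.vel₂_toUV⟩
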